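/- All Banach lattices are real; $E^*$ denotes the topological dual of a Banach lattice $E$ (a Banach lattice with the order $f\le g \iff f(x)\le g(x)$ for all $x\ge 0$), $E^{**}$ its bidual, and $T^*$, $T^{**}$ the first and second adjoints of a bounded linear operator $T$. A linear or multilinear operator between Banach lattices is positive if it maps (tuples of) positive vectors to positive vectors, and regular if it is the difference of two positive operators (it is then continuous). $\mathcal L_r(E;F)$ is the space of regular linear operators from $E$ to $F$, and $\mathcal L_r(E_1,\dots,E_m)$ the space of regular $m$-linear forms $E_1\times\cdots\times E_m\to\mathbb R$. For $A\in\mathcal L_r(E_1,\dots,E_m)$ and $x_m^{**}\in E_m^{**}$ let $\overline{x_m^{**}}(A)\in\mathcal L_r(E_1,\dots,E_{m-1})$ be the form $(x_1,\dots,x_{m-1})\mapsto x_m^{**}\big(A(x_1,\dots,x_{m-1},\bullet)\big)$ (for $m=1$ this is the number $x_1^{**}(A)$). The Arens extension $A^{*[m+1]}\colon E_1^{**}\times\cdots\times E_m^{**}\to\mathbb R$ of $A$ is the $m$-linear form $$A^{*[m+1]}(x_1^{**},\dots,x_m^{**})=\big(\overline{x_1^{**}}\circ\cdots\circ\overline{x_m^{**}}\big)(A).$$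 Let $\mathcal P$ be a property of linear functionals on Banach lattices. A form $B\colon E_1^{**}\times\cdots\times E_m^{**}\to\mathbb R$ has $\mathcal P$ in the $j$-th variable if, for all fixed $x_i^{**}\in E_i^{**}$, $i\ne j$, the functional $x_j^{**}\in E_j^{**}\mapsto B(x_1^{**},\dots,x_m^{**})$ has $\mathcal P$; it has $\mathcal P$ separately if this holds for every $j\in\{1,\dots,m\}$. $\mathcal P$ is an Arens property if for all $m\ge 2$, all Banach lattices $E_1,\dots,E_m$ and all $A\in\mathcal L_r(E_1,\dots,E_m)$, the Arens extension $A^{*[m+1]}$ has $\mathcal P$ in the first variable. **Theorem.** Let $\mathcal P$ be an Arens property, $m\ge 2$, and let $E_1,\dots,E_m$ be Banach lattices. Suppose that: (i) for $j=2,\dots,m-1$ and $i=1,\dots,m-j$, every regular linear operator from $E_j$ to $E_{j+i}^*$ is weakly compact; (ii) for all $k=2,\dots,m$, $x_1^{**}\in E_1^{**}$ and $T\in\mathcal L_r(E_1;E_k^*)$, the functional $T^{**}(x_1^{**})\in E_k^{***}$ on $E_k^{**}$ has $\mathcal P$. Then, for every form $A\in\mathcal L_r(E_1,\dots,E_m)$,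 the Arens extension $A^{*[m+1]}\colon E_1^{**}\times\cdots\times E_m^{**}\to\mathbb R$ has $\mathcal P$ separately. -/

import Mathlib

universe u v w

noncomputable section

namespace BLat

/-- `E` (a real normed space with a lattice order) is a real Banach lattice: the order is compatible
with the vector space structure, the norm is a lattice norm (`|x| ≤ |y| → ‖x‖ ≤ ‖y‖`), and `E` is
complete. -/
class IsBanachLattice (E : Type u) [NormedAddCommGroup E] [NormedSpace ℝ E] [Lattice E] : Prop
    extends IsOrderedAddMonoid E, PosSMulMono ℝ E, HasSolidNorm E, CompleteSpace E

/-- `ℝ` is a Banach lattice. -/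
instance instIsBanachLatticeReal : IsBanachLattice ℝ where

/-! ### The dual Banach lattice

`StrongDual ℝ E` is the space of continuous linear functionals with the operator norm; it is
ordered by `f ≤ g ↔ ∀ x ≥ 0, f x ≤ g x`. -/

section Dual

set_option linter.unusedSectionVars false

variable {E : Type u} [NormedAddCommGroup E] [NormedSpace ℝ E] [Lattice E] [IsBanachLattice E]

theorem norm_le_of_nonneg_of_le {x y : E} (hx : 0 ≤ x) (hxy : x ≤ y) : ‖x‖ ≤ ‖y‖ := by
  apply norm_le_norm_of_abs_le_abs
  rwa [abs_of_nonneg hx, abs_of_nonneg (hx.trans hxy)]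

theorem dual_apply_le (f : StrongDual ℝ E) (x : E) : f x ≤ ‖f‖ * ‖x‖ :=
  (le_abs_self _).trans (f.le_opNorm x)

theorem norm_posPart_le (x : E) : ‖x⁺‖ ≤ ‖x‖ := by
  rw [← norm_abs_eq_norm x]
  refine norm_le_of_nonneg_of_le (posPart_nonneg x) ?_
  rw [← posPart_add_negPart]
  exact le_add_of_nonneg_right (negPart_nonneg x)

theorem norm_negPart_le (x : E) : ‖x⁻‖ ≤ ‖x‖ := by
  rw [← norm_abs_eq_norm x]
  refine norm_le_of_nonneg_of_le (negPart_nonneg x) ?_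
  rw [← posPart_add_negPart]
  exact le_add_of_nonneg_left (posPart_nonneg x)

/-- The Riesz--Kantorovich supremum `sup {f y | 0 ≤ y ≤ x}`. -/
def rk (f : StrongDual ℝ E) (x : E) : ℝ := sSup (f '' Set.Icc 0 x)

theorem rk_bddAbove (f : StrongDual ℝ E) (x : E) : BddAbove (f '' Set.Icc 0 x) := by
  refine ⟨‖f‖ * ‖x‖, ?_⟩
  rintro _ ⟨y, ⟨h0, h1⟩, rfl⟩
  exact (dual_apply_le f y).trans
    (mul_le_mul_of_nonneg_left (norm_le_of_nonneg_of_le h0 h1) (norm_nonneg f))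

theorem le_rk (f : StrongDual ℝ E) {x y : E} (h0 : 0 ≤ y) (h1 : y ≤ x) : f y ≤ rk f x :=
  le_csSup (rk_bddAbove f x) ⟨y, ⟨h0, h1⟩, rfl⟩

theorem rk_le (f : StrongDual ℝ E) {x : E} (hx : 0 ≤ x) {c : ℝ}
    (h : ∀ y, 0 ≤ y → y ≤ x → f y ≤ c) : rk f x ≤ c := by
  refine csSup_le ⟨f 0, 0, ⟨le_rfl, hx⟩, rfl⟩ ?_
  rintro _ ⟨y, ⟨h0, h1⟩, rfl⟩
  exact h y h0 h1

theorem rk_nonneg (f : StrongDual ℝ E) {x : E} (hx : 0 ≤ x) : 0 ≤ rk f x := by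
  simpa using le_rk f le_rfl hx

theorem rk_le_norm (f : StrongDual ℝ E) {x : E} (hx : 0 ≤ x) : rk f x ≤ ‖f‖ * ‖x‖ :=
  rk_le f hx fun y h0 h1 => (dual_apply_le f y).trans
    (mul_le_mul_of_nonneg_left (norm_le_of_nonneg_of_le h0 h1) (norm_nonneg f))

theorem rk_add (f : StrongDual ℝ E) {x y : E} (hx : 0 ≤ x) (hy : 0 ≤ y) :
    rk f (x + y) = rk f x + rk f y := by
  apply le_antisymm
  · refine rk_le f (add_nonneg hx hy) fun z h0 h1 => ?_
    have e : f z = f (z ⊓ x) + f (z - z ⊓ x) := by rw [← map_add]; congr 1; abel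
    rw [e]
    refine add_le_add (le_rk f (le_inf h0 hx) inf_le_right)
      (le_rk f (sub_nonneg.2 inf_le_left) ?_)
    rw [sub_le_iff_le_add, ← sub_le_iff_le_add']
    refine le_inf (sub_le_self z hy) ?_
    rwa [sub_le_iff_le_add]
  · rw [← le_sub_iff_add_le]
    refine rk_le f hx fun a h0 h1 => ?_
    rw [le_sub_comm]
    refine rk_le f hy fun b h2 h3 => ?_
    rw [le_sub_iff_add_le, ← map_add, add_comm b a]
    exact le_rk f (add_nonneg h0 h2) (add_le_add h1 h3)

theorem rk_sub_eq (f : StrongDual ℝ E) {a b c d : E} (ha : 0 ≤ a) (hb : 0 ≤ b) (hc : 0 ≤ c)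
    (hd : 0 ≤ d) (h : a - b = c - d) : rk f a - rk f b = rk f c - rk f d := by
  have h1 : a + d = c + b := sub_eq_sub_iff_add_eq_add.1 h
  have h2 := congrArg (rk f) h1
  rw [rk_add f ha hd, rk_add f hc hb] at h2
  linarith

/-- The positive part `f⁺` of a functional, `f⁺ x = sup {f y | 0 ≤ y ≤ x}` for `x ≥ 0`. -/
def dualPos (f : StrongDual ℝ E) : StrongDual ℝ E :=
  let g : E →+ ℝ := AddMonoidHom.mk' (fun x => rk f x⁺ - rk f x⁻) (by
    intro x y
    have h := rk_sub_eq f (posPart_nonneg (x + y)) (negPart_nonneg (x + y))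
      (add_nonneg (posPart_nonneg x) (posPart_nonneg y))
      (add_nonneg (negPart_nonneg x) (negPart_nonneg y))
      (by rw [posPart_sub_negPart, add_sub_add_comm, posPart_sub_negPart, posPart_sub_negPart])
    rw [h, rk_add f (posPart_nonneg x) (posPart_nonneg y),
      rk_add f (negPart_nonneg x) (negPart_nonneg y)]
    ring)
  g.toRealLinearMap (AddMonoidHomClass.continuous_of_bound g ‖f‖ (by
    intro x
    change |rk f x⁺ - rk f x⁻| ≤ ‖f‖ * ‖x‖
    have h1 := rk_nonneg f (posPart_nonneg x)
    have h2 := rk_nonneg f (negPart_nonneg x)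
    have h3 := (rk_le_norm f (posPart_nonneg x)).trans
      (mul_le_mul_of_nonneg_left (norm_posPart_le x) (norm_nonneg f))
    have h4 := (rk_le_norm f (negPart_nonneg x)).trans
      (mul_le_mul_of_nonneg_left (norm_negPart_le x) (norm_nonneg f))
    rw [abs_le]
    constructor <;> linarith))

theorem dualPos_apply (f : StrongDual ℝ E) {x : E} (hx : 0 ≤ x) : dualPos f x = rk f x := by
  change rk f x⁺ - rk f x⁻ = rk f x
  rw [posPart_of_nonneg hx, negPart_of_nonneg hx]
  have : rk f 0 = 0 := le_antisymm (by simpa using rk_le_norm f (le_refl (0 : E)))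
    (rk_nonneg f le_rfl)
  simp [this]

/-- The order of the dual is the pointwise order on the positive cone. -/
instance instPartialOrderDual : PartialOrder (StrongDual ℝ E) where
  le f g := ∀ x : E, 0 ≤ x → f x ≤ g x
  le_refl _ _ _ := le_rfl
  le_trans _ _ _ h1 h2 x hx := (h1 x hx).trans (h2 x hx)
  le_antisymm f g h1 h2 := by
    ext x
    rw [← posPart_sub_negPart x, map_sub, map_sub,
      le_antisymm (h1 _ (posPart_nonneg x)) (h2 _ (posPart_nonneg x)),
      le_antisymm (h1 _ (negPart_nonneg x)) (h2 _ (negPart_nonneg x))]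

theorem dual_le_def {f g : StrongDual ℝ E} : f ≤ g ↔ ∀ x : E, 0 ≤ x → f x ≤ g x := Iff.rfl

theorem dualPos_nonneg (f : StrongDual ℝ E) : 0 ≤ dualPos f := fun x hx => by
  rw [dualPos_apply f hx]; exact rk_nonneg f hx

theorem le_dualPos (f : StrongDual ℝ E) : f ≤ dualPos f := fun x hx => by
  rw [dualPos_apply f hx]; exact le_rk f hx le_rfl

theorem dualPos_le {f g : StrongDual ℝ E} (h0 : 0 ≤ g) (h : f ≤ g) : dualPos f ≤ g := fun x hx => by
  rw [dualPos_apply f hx]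
  refine rk_le f hx fun y hy hyx => (h y hy).trans ?_
  have := h0 (x - y) (sub_nonneg.2 hyx)
  simpa using this

instance instIsOrderedAddMonoidDual : IsOrderedAddMonoid (StrongDual ℝ E) where
  add_le_add_left _ _ h c x hx := by simpa using h x hx

instance instPosSMulMonoDual : PosSMulMono ℝ (StrongDual ℝ E) where
  smul_le_smul_of_nonneg_left _ hc _ _ h x hx := mul_le_mul_of_nonneg_left (h x hx) hc

/-- The dual is a lattice, with `f ⊔ g = g + (f - g)⁺` and `f ⊓ g = f - (f - g)⁺`. -/
instance instLatticeDual : Lattice (StrongDual ℝ E) where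
  sup f g := g + dualPos (f - g)
  inf f g := f - dualPos (f - g)
  le_sup_left f g := by
    have := le_dualPos (f - g)
    rwa [sub_le_iff_le_add'] at this
  le_sup_right f g := le_add_of_nonneg_right (dualPos_nonneg _)
  sup_le f g h hf hg := by
    rw [← le_sub_iff_add_le']
    exact dualPos_le (sub_nonneg.2 hg) (sub_le_sub_right hf g)
  inf_le_left f g := sub_le_self _ (dualPos_nonneg _)
  inf_le_right f g := by
    rw [sub_le_comm]
    exact le_dualPos _
  le_inf f g h hg hh := by
    rw [le_sub_comm]
    exact dualPos_le (sub_nonneg.2 hg) (sub_le_sub_left hh g)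

theorem dual_sup_def (f g : StrongDual ℝ E) : f ⊔ g = g + dualPos (f - g) := rfl

theorem dual_abs_apply_le (f : StrongDual ℝ E) {x : E} (hx : 0 ≤ x) : |f| x ≤ ‖f‖ * ‖x‖ := by
  have e : |f| x = -f x + dualPos (f - -f) x := rfl
  rw [e, dualPos_apply _ hx, ← le_sub_iff_add_le']
  refine rk_le _ hx fun y h0 h1 => ?_
  have h2 : ‖2 • y - x‖ ≤ ‖x‖ := by
    apply norm_le_norm_of_abs_le_abs
    rw [abs_of_nonneg hx]
    refine abs_le'.2 ⟨?_, ?_⟩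
    · rw [two_nsmul, sub_le_iff_le_add]
      exact add_le_add h1 h1
    · rw [neg_sub, two_nsmul]
      exact sub_le_self _ (add_nonneg h0 h0)
  have h3 := (dual_apply_le f (2 • y - x)).trans (mul_le_mul_of_nonneg_left h2 (norm_nonneg f))
  have h4 : f (2 • y - x) = 2 * f y - f x := by simp
  have h5 : (f - -f) y = 2 * f y := by simp [two_mul]
  rw [h5]
  rw [h4] at h3
  linarith

theorem abs_dual_apply_le (f : StrongDual ℝ E) (x : E) : |f x| ≤ |f| |x| := by
  have h1 : f ≤ |f| := le_abs_self f
  have h2 : -f ≤ |f| := neg_le_abs f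
  have a1 := h1 _ (posPart_nonneg x)
  have a2 := h1 _ (negPart_nonneg x)
  have a3 := h2 _ (posPart_nonneg x)
  have a4 := h2 _ (negPart_nonneg x)
  have e1 : f x = f x⁺ - f x⁻ := by rw [← map_sub, posPart_sub_negPart]
  have e2 : |f| |x| = |f| x⁺ + |f| x⁻ := by rw [← map_add, posPart_add_negPart]
  rw [e1, e2, abs_le]
  simp only [neg_apply] at a3 a4
  constructor <;> linarith

/-- The dual of a Banach lattice is a Banach lattice. -/
instance instIsBanachLatticeDual : IsBanachLattice (StrongDual ℝ E) where
  solid f g h := by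
    refine ContinuousLinearMap.opNorm_le_bound f (norm_nonneg g) fun x => ?_
    rw [Real.norm_eq_abs]
    calc |f x| ≤ |f| |x| := abs_dual_apply_le f x
      _ ≤ |g| |x| := h _ (abs_nonneg x)
      _ ≤ ‖g‖ * ‖|x|‖ := dual_abs_apply_le g (abs_nonneg x)
      _ = ‖g‖ * ‖x‖ := by rw [norm_abs_eq_norm]

end Dual

/-- The bidual of `E`, as a Banach lattice. -/
abbrev Bidual (E : Type u) [NormedAddCommGroup E] [NormedSpace ℝ E] : Type u :=
  StrongDual ℝ (StrongDual ℝ E)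

/-! ### Regular multilinear operators -/

section Regular

variable {ι : Type w} {E : ι → Type u} [∀ i, NormedAddCommGroup (E i)]
  [∀ i, NormedSpace ℝ (E i)] [∀ i, Lattice (E i)]
  {F : Type v} [NormedAddCommGroup F] [NormedSpace ℝ F] [Lattice F]

/-- A multilinear operator is positive if it maps tuples of positive vectors to positive vectors. -/
def IsPositive (A : MultilinearMap ℝ E F) : Prop := ∀ x : ∀ i, E i, (∀ i, 0 ≤ x i) → 0 ≤ A x

/-- A multilinear operator is regular if it is the difference of two positive ones. -/
def IsRegular (A : MultilinearMap ℝ E F) : Prop :=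
  ∃ B C : MultilinearMap ℝ E F, IsPositive B ∧ IsPositive C ∧ A = B - C

variable [∀ i, IsBanachLattice (E i)] [IsBanachLattice F]

theorem IsPositive.mono [Fintype ι] {A : MultilinearMap ℝ E F} (hA : IsPositive A) {x y : ∀ i, E i}
    (hx : ∀ i, 0 ≤ x i) (hxy : ∀ i, x i ≤ y i) : A x ≤ A y := by
  classical
  have e : y = x + (y - x) := by abel
  rw [e, A.map_add_univ]
  have h : ∀ s ∈ (Finset.univ : Finset (Finset ι)), 0 ≤ A (s.piecewise x (y - x)) := by
    intro s _
    refine hA _ fun i => ?_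
    by_cases hi : i ∈ s
    · simpa [hi] using hx i
    · simpa [hi] using hxy i
  have := Finset.single_le_sum h (Finset.mem_univ Finset.univ)
  simpa using this

theorem IsPositive.bound_on_cone [Fintype ι] {A : MultilinearMap ℝ E F} (hA : IsPositive A) :
    ∃ C : ℝ, 0 ≤ C ∧ ∀ x : ∀ i, E i, (∀ i, 0 ≤ x i) → ‖A x‖ ≤ C * ∏ i, ‖x i‖ := by
  by_contra hcon
  push Not at hcon
  have key : ∀ n : ℕ, ∃ w : ∀ i, E i, (∀ i, 0 ≤ w i) ∧ (∀ i, ‖w i‖ = 1) ∧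
      ((2 : ℝ) ^ n) ^ Fintype.card ι * n < ‖A w‖ := by
    intro n
    obtain ⟨x, hx, hlt⟩ := hcon (((2 : ℝ) ^ n) ^ Fintype.card ι * n) (by positivity)
    have hne : ∀ i, ‖x i‖ ≠ 0 := by
      intro i hi
      rw [A.map_coord_zero i (norm_eq_zero.1 hi), norm_zero] at hlt
      exact absurd hlt (not_lt.2 (by positivity))
    refine ⟨fun i => ‖x i‖⁻¹ • x i, fun i => smul_nonneg (by positivity) (hx i), fun i => ?_, ?_⟩
    · rw [norm_smul, norm_inv, norm_norm, inv_mul_cancel₀ (hne i)]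
    · rw [A.map_smul_univ, norm_smul, Finset.prod_inv_distrib, norm_inv, Real.norm_eq_abs,
        abs_of_nonneg (Finset.prod_nonneg fun i _ => norm_nonneg (x i)), inv_mul_eq_div,
        lt_div_iff₀ (Finset.prod_pos fun i _ => (norm_nonneg (x i)).lt_of_ne' (hne i))]
      exact hlt
  choose w hw0 hw1 hw2 using key
  have hs : ∀ i, Summable fun n : ℕ => ((1 : ℝ) / 2) ^ n • w n i := by
    intro i
    refine Summable.of_norm ?_
    simp_rw [norm_smul, hw1, mul_one, norm_pow, norm_div, norm_one, Real.norm_ofNat]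
    exact summable_geometric_two
  set y : ∀ i, E i := fun i => ∑' n : ℕ, ((1 : ℝ) / 2) ^ n • w n i with hy
  have hle : ∀ (n : ℕ) i, w n i ≤ (2 : ℝ) ^ n • y i := by
    intro n i
    have h1 : ((1 : ℝ) / 2) ^ n • w n i ≤ y i :=
      (hs i).le_tsum n fun k _ => smul_nonneg (by positivity) (hw0 k i)
    have h2 := smul_le_smul_of_nonneg_left h1 (by positivity : (0 : ℝ) ≤ 2 ^ n)
    rwa [smul_smul, ← mul_pow, mul_one_div_cancel two_ne_zero, one_pow, one_smul] at h2
  obtain ⟨n, hn⟩ := exists_nat_gt ‖A y‖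
  have h1 := norm_le_of_nonneg_of_le (hA _ (hw0 n)) (hA.mono (hw0 n) (hle n))
  rw [A.map_smul_univ, norm_smul, Finset.prod_const, Finset.card_univ, norm_pow, norm_pow,
    Real.norm_ofNat] at h1
  have h2 := lt_of_mul_lt_mul_left ((hw2 n).trans_le h1) (by positivity)
  exact lt_asymm h2 hn

theorem IsPositive.continuous [Fintype ι] {A : MultilinearMap ℝ E F} (hA : IsPositive A) :
    Continuous A := by
  classical
  obtain ⟨C, hC, hb⟩ := hA.bound_on_cone
  refine A.continuous_of_bound (∑ _s : Finset ι, C) fun x => ?_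
  have e : x = (fun i => (x i)⁺) + fun i => -(x i)⁻ := by
    funext i
    simp [← sub_eq_add_neg, posPart_sub_negPart]
  conv_lhs => rw [e, A.map_add_univ]
  refine (norm_sum_le _ _).trans ?_
  rw [Finset.sum_mul]
  refine Finset.sum_le_sum fun s _ => ?_
  have e2 : (s.piecewise (fun i => (x i)⁺) fun i => -(x i)⁻) =
      fun i => (if i ∈ s then (1 : ℝ) else -1) • (if i ∈ s then (x i)⁺ else (x i)⁻) := by
    funext i
    by_cases hi : i ∈ s <;> simp [hi]
  have hprod : ‖∏ i, (if i ∈ s then (1 : ℝ) else -1)‖ = 1 := by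
    rw [norm_prod]
    refine Finset.prod_eq_one fun i _ => ?_
    split_ifs <;> simp
  rw [e2, A.map_smul_univ, norm_smul, hprod, one_mul]
  refine (hb _ fun i => ?_).trans (mul_le_mul_of_nonneg_left
    (Finset.prod_le_prod (fun _ _ => norm_nonneg _) fun i _ => ?_) hC)
  · split_ifs
    · exact posPart_nonneg _
    · exact negPart_nonneg _
  · split_ifs
    · exact norm_posPart_le _
    · exact norm_negPart_le _

/-- Regular multilinear operators between Banach lattices are continuous. -/
theorem IsRegular.continuous [Fintype ι] {A : MultilinearMap ℝ E F} (hA : IsRegular A) :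
    Continuous A := by
  obtain ⟨B, C, hB, hC, rfl⟩ := hA
  exact hB.continuous.sub hC.continuous

/-- A regular multilinear operator between Banach lattices, as a continuous multilinear map. -/
def IsRegular.toContinuous [Fintype ι] {A : MultilinearMap ℝ E F} (hA : IsRegular A) :
    ContinuousMultilinearMap ℝ E F :=
  ⟨A, hA.continuous⟩

end Regular

/-! ### Regular linear operators -/

section Linear

variable {E : Type u} [NormedAddCommGroup E] [NormedSpace ℝ E] [Lattice E]
  {F : Type v} [NormedAddCommGroup F] [NormedSpace ℝ F] [Lattice F]

/-- A linear operator is positive if it maps positive vectors to positive vectors. -/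
def IsPositiveOp (T : E →ₗ[ℝ] F) : Prop := ∀ x : E, 0 ≤ x → 0 ≤ T x

/-- A linear operator is regular if it is the difference of two positive ones. -/
def IsRegularOp (T : E →ₗ[ℝ] F) : Prop :=
  ∃ R S : E →ₗ[ℝ] F, IsPositiveOp R ∧ IsPositiveOp S ∧ T = R - S

theorem IsPositiveOp.continuous [IsBanachLattice E] [IsBanachLattice F] {T : E →ₗ[ℝ] F}
    (hT : IsPositiveOp T) : Continuous T := by
  have h : IsPositive (MultilinearMap.ofSubsingleton ℝ E F (0 : Fin 1) T) :=
    fun x hx => hT (x 0) (hx 0)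
  exact h.continuous.comp (continuous_pi fun _ => continuous_id : Continuous fun x : E => fun _ => x)

/-- Regular linear operators between Banach lattices are continuous. -/
theorem IsRegularOp.continuous [IsBanachLattice E] [IsBanachLattice F] {T : E →ₗ[ℝ] F}
    (hT : IsRegularOp T) : Continuous T := by
  obtain ⟨R, S, hR, hS, rfl⟩ := hT
  exact hR.continuous.sub hS.continuous

/-- A regular linear operator between Banach lattices, as a continuous linear map. -/
def IsRegularOp.toContinuous [IsBanachLattice E] [IsBanachLattice F] {T : E →ₗ[ℝ] F}
    (hT : IsRegularOp T) : E →L[ℝ] F :=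
  ⟨T, hT.continuous⟩

end Linear

/-- A linear operator is weakly compact if the image of the closed unit ball is relatively compact
in the weak topology. -/
def IsWeaklyCompactOp {E : Type u} [NormedAddCommGroup E] [NormedSpace ℝ E]
    {F : Type v} [NormedAddCommGroup F] [NormedSpace ℝ F] (T : E →ₗ[ℝ] F) : Prop :=
  IsCompact (closure (toWeakSpace ℝ F '' (T '' Metric.closedBall 0 1)))

/-- The adjoint `T* : F* → E*`, `T* φ = φ ∘ T`, of a bounded linear operator `T : E → F`. -/
def adjointOp {E : Type u} [NormedAddCommGroup E] [NormedSpace ℝ E]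
    {F : Type v} [NormedAddCommGroup F] [NormedSpace ℝ F] (T : E →L[ℝ] F) :
    StrongDual ℝ F →L[ℝ] StrongDual ℝ E :=
  (ContinuousLinearMap.compL ℝ E F ℝ).flip T

/-! ### The Arens extension -/

section Arens

/-- For `x'' ∈ E_{m+1}**`, the operator sending an `(m+1)`-linear form `A` to the `m`-linear form
`(x₁, …, x_m) ↦ x''(A(x₁, …, x_m, •))`. -/
def contractLast {m : ℕ} {E : Fin (m + 1) → Type u} [∀ i, NormedAddCommGroup (E i)]
    [∀ i, NormedSpace ℝ (E i)] (x : Bidual (E (Fin.last m))) (A : ContinuousMultilinearMap ℝ E ℝ) :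
    ContinuousMultilinearMap ℝ (fun i : Fin m => E i.castSucc) ℝ :=
  x.compContinuousMultilinearMap A.curryRight

/-- The value at `(x₁'', …, x_m'')` of the Arens extension of `A`: the bidual vectors are applied
one after the other, starting with the last variable and ending with the first one. -/
def arensValue : (m : ℕ) → (E : Fin m → Type u) → [∀ i, NormedAddCommGroup (E i)] →
    [∀ i, NormedSpace ℝ (E i)] → ContinuousMultilinearMap ℝ E ℝ → (∀ i, Bidual (E i)) → ℝ
  | 0, _, _, _, A, _ => A fun i => i.elim0
  | m + 1, E, _, _, A, x =>
    arensValue m (fun i => E i.castSucc) (contractLast (x (Fin.last m)) A) fun i => x i.castSucc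

theorem arensValue_add {m : ℕ} {E : Fin m → Type u} [∀ i, NormedAddCommGroup (E i)]
    [∀ i, NormedSpace ℝ (E i)] (A B : ContinuousMultilinearMap ℝ E ℝ) (x : ∀ i, Bidual (E i)) :
    arensValue m E (A + B) x = arensValue m E A x + arensValue m E B x := by
  induction m with
  | zero => rfl
  | succ m ih =>
    simp only [arensValue]
    rw [← ih]
    congr 1
    ext y
    simp only [contractLast, add_apply,
      ContinuousLinearMap.compContinuousMultilinearMap_coe, Function.comp_apply]
    rw [← map_add]
    rfl

theorem arensValue_smul {m : ℕ} {E : Fin m → Type u} [∀ i, NormedAddCommGroup (E i)]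
    [∀ i, NormedSpace ℝ (E i)] (c : ℝ) (A : ContinuousMultilinearMap ℝ E ℝ)
    (x : ∀ i, Bidual (E i)) : arensValue m E (c • A) x = c • arensValue m E A x := by
  induction m with
  | zero => rfl
  | succ m ih =>
    simp only [arensValue]
    rw [← ih]
    congr 1
    ext y
    simp only [contractLast, smul_apply,
      ContinuousLinearMap.compContinuousMultilinearMap_coe, Function.comp_apply]
    rw [← map_smul]
    rfl

theorem arensValue_update_add {m : ℕ} {E : Fin m → Type u} [∀ i, NormedAddCommGroup (E i)]
    [∀ i, NormedSpace ℝ (E i)] (A : ContinuousMultilinearMap ℝ E ℝ) (x : ∀ i, Bidual (E i))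
    (j : Fin m) (a b : Bidual (E j)) :
    arensValue m E A (Function.update x j (a + b)) =
      arensValue m E A (Function.update x j a) + arensValue m E A (Function.update x j b) := by
  induction m with
  | zero => exact j.elim0
  | succ m ih =>
    simp only [arensValue]
    induction j using Fin.lastCases with
    | last =>
      have h : ∀ c : Bidual (E (Fin.last m)),
          (fun i : Fin m => Function.update x (Fin.last m) c i.castSucc) =
            fun i : Fin m => x i.castSucc := fun c => by
        funext i
        exact Function.update_of_ne i.castSucc_lt_last.ne _ _
      simp only [h, Function.update_self]
      rw [← arensValue_add]
      rfl
    | cast j =>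
      have h : ∀ c : Bidual (E j.castSucc),
          (fun i : Fin m => Function.update x j.castSucc c i.castSucc) =
            Function.update (fun i : Fin m => x i.castSucc) j c := fun c => by
        funext i
        by_cases hi : i = j
        · subst hi; simp
        · rw [Function.update_of_ne hi, Function.update_of_ne (by simpa using hi)]
      simp only [h, Function.update_of_ne (j.castSucc_lt_last.ne')]
      exact ih _ _ _ _ _

theorem arensValue_update_smul {m : ℕ} {E : Fin m → Type u} [∀ i, NormedAddCommGroup (E i)]
    [∀ i, NormedSpace ℝ (E i)] (A : ContinuousMultilinearMap ℝ E ℝ) (x : ∀ i, Bidual (E i))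
    (j : Fin m) (c : ℝ) (a : Bidual (E j)) :
    arensValue m E A (Function.update x j (c • a)) =
      c • arensValue m E A (Function.update x j a) := by
  induction m with
  | zero => exact j.elim0
  | succ m ih =>
    simp only [arensValue]
    induction j using Fin.lastCases with
    | last =>
      have h : ∀ c : Bidual (E (Fin.last m)),
          (fun i : Fin m => Function.update x (Fin.last m) c i.castSucc) =
            fun i : Fin m => x i.castSucc := fun c => by
        funext i
        exact Function.update_of_ne i.castSucc_lt_last.ne _ _
      simp only [h, Function.update_self]
      rw [← arensValue_smul]
      rfl
    | cast j =>
      have h : ∀ c : Bidual (E j.castSucc),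
          (fun i : Fin m => Function.update x j.castSucc c i.castSucc) =
            Function.update (fun i : Fin m => x i.castSucc) j c := fun c => by
        funext i
        by_cases hi : i = j
        · subst hi; simp
        · rw [Function.update_of_ne hi, Function.update_of_ne (by simpa using hi)]
      simp only [h, Function.update_of_ne (j.castSucc_lt_last.ne')]
      exact ih _ _ _ _

/-- The Arens extension `A^{*[m+1]} : E₁** × ⋯ × E_m** → ℝ` of an `m`-linear form `A`. -/
def arensExtension {m : ℕ} {E : Fin m → Type u} [∀ i, NormedAddCommGroup (E i)]
    [∀ i, NormedSpace ℝ (E i)] (A : ContinuousMultilinearMap ℝ E ℝ) :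
    MultilinearMap ℝ (fun i => Bidual (E i)) ℝ :=
  MultilinearMap.mk' (arensValue m E A) (arensValue_update_add A) (arensValue_update_smul A)

end Arens

/-! ### Properties of linear functionals on Banach lattices -/

/-- A property of linear functionals on Banach lattices. -/
abbrev FunctionalProperty : Type (u + 1) :=
  ∀ (E : Type u) [NormedAddCommGroup E] [NormedSpace ℝ E] [Lattice E] [IsBanachLattice E],
    (E →ₗ[ℝ] ℝ) → Prop

section Property

variable {m : ℕ} {E : Fin m → Type u} [∀ i, NormedAddCommGroup (E i)] [∀ i, NormedSpace ℝ (E i)]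
  [∀ i, Lattice (E i)] [∀ i, IsBanachLattice (E i)]

/-- The form `B` on `E₁** × ⋯ × E_m**` has `P` in the `j`-th variable: whenever the other variables
are fixed, the resulting functional on `E_j**` has `P`. (The entry `x j` plays no role, as
`B.toLinearMap x j` is the functional `z ↦ B (Function.update x j z)`.) -/
def HasInVariable (P : FunctionalProperty.{u}) (B : MultilinearMap ℝ (fun i => Bidual (E i)) ℝ)
    (j : Fin m) : Prop :=
  ∀ x : ∀ i, Bidual (E i), P (Bidual (E j)) (B.toLinearMap x j)

/-- The form `B` on `E₁** × ⋯ × E_m**` has `P` separately. -/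
def HasSeparately (P : FunctionalProperty.{u})
    (B : MultilinearMap ℝ (fun i => Bidual (E i)) ℝ) : Prop :=
  ∀ j, HasInVariable P B j

end Property

/-- `P` is an Arens property: the Arens extension of every regular `m`-linear form, `m ≥ 2`, on
Banach lattices has `P` in the first variable. -/
def IsArensProperty (P : FunctionalProperty.{u}) : Prop :=
  ∀ (m : ℕ) (hm : 2 ≤ m) (E : Fin m → Type u) [∀ i, NormedAddCommGroup (E i)]
    [∀ i, NormedSpace ℝ (E i)] [∀ i, Lattice (E i)] [∀ i, IsBanachLattice (E i)]
    (A : MultilinearMap ℝ E ℝ) (hA : IsRegular A),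
    HasInVariable P (arensExtension hA.toContinuous) ⟨0, by omega⟩

end BLat

end

/-! In the first variable the claim is the definition of an Arens property. For any other index `j`,
the functional `z ↦ A^{*[m+1]}(…, z, …)` turns out to be `T**(x₁'')` for a regular `T : E₁ → E_j*`,
so hypothesis (ii) finishes the proof. To find `T`, contract the variables after `j` by their bidual
vectors; the form stays regular and `z` now sits in the last place
(`exists_regularOp_arensValue_update`). Read the form as a regular `E_j*`-valued map composed with
`z`. The Arens order applies `z` before the vectors `x_i''` with `1 < i < j`, but `z` can be moved
past each of them: for a weakly compact `S : E_i → E_j*`, the vector `S**(x_i'')` lies in `E_j*`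
itself, so applying `z` or `x_i''` first gives the same number (`IsWeaklyCompactOp.bidual_comm`).
Hypothesis (i) supplies the weak compactness. Once these vectors are absorbed, a regular operator
`T` on `E₁` remains and the value is `x₁''(z ∘ T)` (`exists_regularOp_arensValue_comp`). -/

noncomputable section

namespace BLat

/-! ### Weak compactness and interchange of bidual vectors -/

section WeaklyCompact

variable {E : Type u} [NormedAddCommGroup E] [NormedSpace ℝ E]
  {F : Type v} [NormedAddCommGroup F] [NormedSpace ℝ F]

/-- The algebraic dual of `F*` with the topology of pointwise convergence. -/
abbrev PointwiseBidual (F : Type v) [NormedAddCommGroup F] [NormedSpace ℝ F] : Type v :=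
  WeakBilin (LinearMap.id : (StrongDual ℝ F →ₗ[ℝ] ℝ) →ₗ[ℝ] StrongDual ℝ F →ₗ[ℝ] ℝ)

/-- Needed so that the image of a weakly compact set is closed, as Hahn–Banach separation requires.
-/
instance instT2SpacePointwiseBidual : T2Space (PointwiseBidual F) :=
  (WeakBilin.isEmbedding Function.injective_id).t2Space

/-- The canonical embedding of `F` with its weak topology into the algebraic dual of `F*`. -/
def weakSpaceToBidual (F : Type v) [NormedAddCommGroup F] [NormedSpace ℝ F] :
    WeakSpace ℝ F →L[ℝ] PointwiseBidual F where
  toLinearMap := (topDualPairing ℝ F).flip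
  cont := WeakBilin.continuous_of_continuous_eval _ fun w =>
    WeakBilin.eval_continuous (topDualPairing ℝ F).flip w

/-- The second adjoint of a weakly compact operator takes its values in the image of `F`. -/
theorem IsWeaklyCompactOp.exists_bidual_apply_eq (T : E →L[ℝ] F)
    (hT : IsWeaklyCompactOp T.toLinearMap) (x : StrongDual ℝ (StrongDual ℝ E)) :
    ∃ k : F, ∀ w : StrongDual ℝ F, x (w.comp T) = w k := by
  -- Reduction to the unit ball; dividing by `‖x‖ + 1` rather than `‖x‖` avoids a separate case `x =
  -- 0`.
  suffices key : ∀ x : StrongDual ℝ (StrongDual ℝ E), ‖x‖ ≤ 1 →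
      ∃ k : F, ∀ w : StrongDual ℝ F, x (w.comp T) = w k by
    have hc : 0 < ‖x‖ + 1 := by positivity
    obtain ⟨k, hk⟩ := key ((‖x‖ + 1)⁻¹ • x) (by
      refine (ContinuousLinearMap.opNorm_smul_le _ _).trans ?_
      rw [norm_inv, Real.norm_of_nonneg hc.le, inv_mul_le_iff₀ hc]
      linarith)
    refine ⟨(‖x‖ + 1) • k, fun w => ?_⟩
    rw [map_smul, ← hk w, smul_apply, smul_inv_smul₀ hc.ne']
  intro x hx
  let K : Set (WeakSpace ℝ F) :=
    closure (toWeakSpace ℝ F '' (T.toLinearMap '' Metric.closedBall 0 1))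
  let S := weakSpaceToBidual F '' K
  have hK : Convex ℝ K :=
    (((convex_closedBall (0 : E) 1).linear_image T.toLinearMap).linear_image
      (toWeakSpace ℝ F).toLinearMap).closure
  have hS : Convex ℝ S := hK.linear_image (weakSpaceToBidual F).toLinearMap
  have hSc : IsClosed S := (IsCompact.image hT (weakSpaceToBidual F).continuous).isClosed
  -- `Φ` is `T** x` as a point of the algebraic dual of `F*`. It must lie in the convex compact set
  -- `S`; otherwise a functional separates it strictly from `S`.
  let Φ : StrongDual ℝ F →ₗ[ℝ] ℝ := (adjointOp (adjointOp T) x).toLinearMap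
  by_cases hmem : (Φ : PointwiseBidual F) ∈ S
  · obtain ⟨k, -, hk⟩ := hmem
    refine ⟨(toWeakSpace ℝ F).symm k, fun w => ?_⟩
    exact (LinearMap.congr_fun (show (topDualPairing ℝ F).flip k = Φ from hk) w).symm
  · obtain ⟨f, a, hfS, hfΦ⟩ := geometric_hahn_banach_closed_point hS hSc hmem
    -- Functionals continuous for pointwise convergence are evaluations, so the separation is
    -- carried out by some `w ∈ F*`.
    obtain ⟨w, rfl⟩ := LinearMap.dualEmbedding_surjective
      (LinearMap.id : (StrongDual ℝ F →ₗ[ℝ] ℝ) →ₗ[ℝ] StrongDual ℝ F →ₗ[ℝ] ℝ) f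
    have h1 : ∀ y : E, ‖y‖ ≤ 1 → w (T y) < a := fun y hy =>
      hfS _ ⟨_, subset_closure ⟨_, ⟨y, by simpa using hy, rfl⟩, rfl⟩, rfl⟩
    have h2 : a < x (w.comp T) := hfΦ
    have ha : 0 ≤ a := by simpa using (h1 0 (by simp)).le
    -- The unit ball is symmetric, so the one-sided bound `h1` bounds `|w (T y)|`; then `‖x‖ ≤ 1`
    -- contradicts `h2`.
    have h3 : ‖w.comp T‖ ≤ a := by
      refine ContinuousLinearMap.opNorm_le_of_unit_norm ha fun y hy => ?_
      rw [Real.norm_eq_abs, abs_le]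
      have hn := h1 (-y) (by rw [norm_neg, hy])
      have hp := h1 y hy.le
      rw [map_neg, map_neg] at hn
      exact ⟨by rw [ContinuousLinearMap.comp_apply]; linarith, hp.le⟩
    have h4 : x (w.comp T) ≤ a := (le_abs_self _).trans <| (x.le_opNorm _).trans <|
      (mul_le_of_le_one_left (norm_nonneg _) hx).trans h3
    exact absurd h2 h4.not_gt

/-- Second adjoints of weakly compact operators into a dual space: the two iterated limits agree. -/
theorem IsWeaklyCompactOp.bidual_comm {G : Type v} [NormedAddCommGroup G] [NormedSpace ℝ G]
    (T : E →L[ℝ] StrongDual ℝ G) (hT : IsWeaklyCompactOp T.toLinearMap)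
    (x : StrongDual ℝ (StrongDual ℝ E)) (z : StrongDual ℝ (StrongDual ℝ G)) :
    x (z.comp T) = z (x.comp T.flip) := by
  obtain ⟨k, hk⟩ := IsWeaklyCompactOp.exists_bidual_apply_eq T hT x
  rw [hk z]
  congr 1
  ext g
  -- Testing `hk` on the evaluation at `g` identifies `k` with `x ∘ T.flip`.
  exact (hk (NormedSpace.inclusionInDoubleDual ℝ G g)).symm

end WeaklyCompact

/-! ### Regularity under freezing and contracting variables -/

section RegularContraction

variable {E : Type u} [NormedAddCommGroup E] [NormedSpace ℝ E] [Lattice E]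
  {F : Type v} [NormedAddCommGroup F] [NormedSpace ℝ F] [Lattice F]

theorem IsPositiveOp.isRegularOp {T : E →ₗ[ℝ] F} (hT : IsPositiveOp T) : IsRegularOp T :=
  ⟨T, 0, hT, fun _ _ => le_rfl, (sub_zero T).symm⟩

theorem IsRegularOp.neg {T : E →ₗ[ℝ] F} (hT : IsRegularOp T) : IsRegularOp (-T) := by
  obtain ⟨R, S, hR, hS, rfl⟩ := hT
  exact ⟨S, R, hS, hR, neg_sub R S⟩

theorem IsPositive.curryRight_apply {m : ℕ} {E : Fin (m + 1) → Type u}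
    [∀ i, NormedAddCommGroup (E i)] [∀ i, NormedSpace ℝ (E i)] [∀ i, Lattice (E i)]
    {A : MultilinearMap ℝ E F} (hA : IsPositive A)
    {e : ∀ i : Fin m, E i.castSucc} (he : ∀ i, 0 ≤ e i) : IsPositiveOp (A.curryRight e) := by
  intro y hy
  refine hA _ fun i => ?_
  induction i using Fin.lastCases with
  | last => simpa using hy
  | cast i => simpa using he i

variable [IsBanachLattice F]

theorem IsRegularOp.add {S T : E →ₗ[ℝ] F} (hS : IsRegularOp S) (hT : IsRegularOp T) :
    IsRegularOp (S + T) := by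
  obtain ⟨R, R', hR, hR', rfl⟩ := hS
  obtain ⟨S, S', hS, hS', rfl⟩ := hT
  exact ⟨R + S, R' + S', fun x hx => add_nonneg (hR x hx) (hS x hx),
    fun x hx => add_nonneg (hR' x hx) (hS' x hx), by abel⟩

theorem IsRegularOp.sum {ι : Type*} {s : Finset ι} {T : ι → E →ₗ[ℝ] F}
    (hT : ∀ i ∈ s, IsRegularOp (T i)) : IsRegularOp (∑ i ∈ s, T i) :=
  Finset.sum_induction T IsRegularOp (fun _ _ => IsRegularOp.add)
    (IsPositiveOp.isRegularOp fun _ _ => le_rfl) hT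

theorem IsRegularOp.smul {T : E →ₗ[ℝ] F} (hT : IsRegularOp T) (c : ℝ) : IsRegularOp (c • T) := by
  have key : ∀ c : ℝ, 0 ≤ c → IsRegularOp (c • T) := fun c hc => by
    obtain ⟨R, S, hR, hS, rfl⟩ := hT
    exact ⟨c • R, c • S, fun x hx => smul_nonneg hc (hR x hx),
      fun x hx => smul_nonneg hc (hS x hx), smul_sub c R S⟩
  rcases le_total 0 c with hc | hc
  · exact key c hc
  · simpa using (key (-c) (neg_nonneg.2 hc)).neg

variable {m : ℕ} {E : Fin (m + 1) → Type u} [∀ i, NormedAddCommGroup (E i)]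
  [∀ i, NormedSpace ℝ (E i)] [∀ i, Lattice (E i)] [∀ i, IsBanachLattice (E i)]

/-- Splitting each frozen vector as `e⁺ - e⁻` and expanding by multilinearity leaves a signed sum of
positive operators. -/
theorem IsPositive.isRegularOp_curryRight_apply {A : MultilinearMap ℝ E F} (hA : IsPositive A)
    (e : ∀ i : Fin m, E i.castSucc) : IsRegularOp (A.curryRight e) := by
  classical
  have he : e = (fun i => (e i)⁺) + fun i => -(e i)⁻ := by
    funext i
    simp [← sub_eq_add_neg, posPart_sub_negPart]
  rw [he, A.curryRight.map_add_univ]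
  refine IsRegularOp.sum fun s _ => ?_
  have hs : (s.piecewise (fun i => (e i)⁺) fun i => -(e i)⁻) =
      fun i => (if i ∈ s then (1 : ℝ) else -1) • (if i ∈ s then (e i)⁺ else (e i)⁻) := by
    funext i
    by_cases hi : i ∈ s <;> simp [hi]
  rw [hs, MultilinearMap.map_smul_univ]
  refine (hA.curryRight_apply fun i => ?_).isRegularOp.smul _
  split_ifs
  · exact posPart_nonneg _
  · exact negPart_nonneg _

theorem IsRegular.isRegularOp_curryRight_apply {A : MultilinearMap ℝ E F} (hA : IsRegular A)
    (e : ∀ i : Fin m, E i.castSucc) : IsRegularOp (A.curryRight e) := by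
  obtain ⟨B, C, hB, hC, rfl⟩ := hA
  have h := (hB.isRegularOp_curryRight_apply e).add (hC.isRegularOp_curryRight_apply e).neg
  rwa [← sub_eq_add_neg] at h

/-- Composing the last currying of a regular map with a functional-valued contraction that is
linear in `x` and preserves positivity yields a regular map. -/
theorem IsRegular.contract {A : ContinuousMultilinearMap ℝ E F}
    (hA : IsRegular A.toMultilinearMap)
    {V : Type*} [AddCommGroup V] [Module ℝ V] [Lattice V] [IsOrderedAddMonoid V]
    {H : Type*} [NormedAddCommGroup H] [NormedSpace ℝ H] [Lattice H] [IsBanachLattice H]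
    (Ψ : V →ₗ[ℝ] (E (Fin.last m) →L[ℝ] F) →L[ℝ] H)
    (hΨ : ∀ x, 0 ≤ x → ∀ S : E (Fin.last m) →L[ℝ] F, IsPositiveOp S.toLinearMap → 0 ≤ Ψ x S)
    (x : V) :
    IsRegular ((Ψ x).compContinuousMultilinearMap A.curryRight).toMultilinearMap := by
  obtain ⟨B, C, hB, hC, hBC⟩ := hA
  -- Positive multilinear maps are automatically continuous, so `B` and `C` can be contracted as
  -- well.
  let B' : ContinuousMultilinearMap ℝ E F := ⟨B, hB.continuous⟩
  let C' : ContinuousMultilinearMap ℝ E F := ⟨C, hC.continuous⟩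
  let M (D : ContinuousMultilinearMap ℝ E F) (y : V) :
      MultilinearMap ℝ (fun i : Fin m => E i.castSucc) H :=
    ((Ψ y).compContinuousMultilinearMap D.curryRight).toMultilinearMap
  have hpos : ∀ D : ContinuousMultilinearMap ℝ E F, IsPositive D.toMultilinearMap → ∀ y : V, 0 ≤ y →
      IsPositive (M D y) :=
    fun D hD y hy e he => hΨ y hy (D.curryRight e) (hD.curryRight_apply he)
  -- These are the terms with plus and with minus sign in the expansion of `(x⁺ - x⁻)` applied to `B
  -- - C`.
  refine ⟨M B' x⁺ + M C' x⁻, M B' x⁻ + M C' x⁺,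
    fun e he => add_nonneg (hpos B' hB x⁺ (posPart_nonneg x) e he)
      (hpos C' hC x⁻ (negPart_nonneg x) e he),
    fun e he => add_nonneg (hpos B' hB x⁻ (negPart_nonneg x) e he)
      (hpos C' hC x⁺ (posPart_nonneg x) e he), ?_⟩
  ext e
  have hA' : A.curryRight e = B'.curryRight e - C'.curryRight e := by
    ext y
    exact congrArg (fun D : MultilinearMap ℝ E F => D (Fin.snoc e y)) hBC
  change Ψ x (A.curryRight e) = Ψ x⁺ (B'.curryRight e) + Ψ x⁻ (C'.curryRight e) -
    (Ψ x⁻ (B'.curryRight e) + Ψ x⁺ (C'.curryRight e))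
  rw [hA', map_sub]
  conv_lhs => rw [← posPart_sub_negPart x, map_sub]
  simp only [sub_apply]
  abel

end RegularContraction

/-! ### Contraction of the last variable -/

/-- For `x ∈ E**`, the operator sending `T : E → G*` to the functional `g ↦ x (y ↦ T y g)`. -/
def contractDual (E : Type u) [NormedAddCommGroup E] [NormedSpace ℝ E]
    (G : Type v) [NormedAddCommGroup G] [NormedSpace ℝ G] :
    StrongDual ℝ (StrongDual ℝ E) →ₗ[ℝ] (E →L[ℝ] StrongDual ℝ G) →L[ℝ] StrongDual ℝ G where
  toFun x := (ContinuousLinearMap.compL ℝ G (StrongDual ℝ E) ℝ x).comp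
    (ContinuousLinearMap.flipₗᵢ ℝ E G ℝ).toContinuousLinearEquiv.toContinuousLinearMap
  map_add' x y := by ext; rfl
  map_smul' c x := by ext; rfl

section

variable {m : ℕ} {E : Fin (m + 1) → Type u} [∀ i, NormedAddCommGroup (E i)]
  [∀ i, NormedSpace ℝ (E i)] [∀ i, Lattice (E i)] [∀ i, IsBanachLattice (E i)]

theorem IsRegular.contractLast {A : ContinuousMultilinearMap ℝ E ℝ}
    (hA : IsRegular A.toMultilinearMap) (x : Bidual (E (Fin.last m))) :
    IsRegular (BLat.contractLast x A).toMultilinearMap := by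
  have h := hA.contract (V := Bidual (E (Fin.last m))) (H := ℝ)
    (LinearMap.id : Bidual (E (Fin.last m)) →ₗ[ℝ] Bidual (E (Fin.last m)))
    (fun _ hx S hS => dual_le_def.1 hx S hS) x
  exact h

theorem IsRegular.contractDual {G : Type u} [NormedAddCommGroup G] [NormedSpace ℝ G] [Lattice G]
    [IsBanachLattice G] {A : ContinuousMultilinearMap ℝ E (StrongDual ℝ G)}
    (hA : IsRegular A.toMultilinearMap) (x : Bidual (E (Fin.last m))) :
    IsRegular ((BLat.contractDual (E (Fin.last m)) G x).compContinuousMultilinearMap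
      A.curryRight).toMultilinearMap :=
  hA.contract (V := Bidual (E (Fin.last m))) (BLat.contractDual _ G)
    (fun _ hx S hS g hg => dual_le_def.1 hx (S.flip g) fun y hy => hS y hy g hg) x

/-- Turns a form into a dual-valued map, so that the bidual vector in the last place becomes the `z`
composed with it. -/
theorem IsRegular.curryRight {A : ContinuousMultilinearMap ℝ E ℝ}
    (hA : IsRegular A.toMultilinearMap) : IsRegular A.curryRight.toMultilinearMap := by
  obtain ⟨B, C, hB, hC, hBC⟩ := hA
  refine ⟨(⟨B, hB.continuous⟩ : ContinuousMultilinearMap ℝ E ℝ).curryRight.toMultilinearMap,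
    (⟨C, hC.continuous⟩ : ContinuousMultilinearMap ℝ E ℝ).curryRight.toMultilinearMap,
    fun e he => hB.curryRight_apply he, fun e he => hC.curryRight_apply he, ?_⟩
  ext e y
  exact congrArg (fun D : MultilinearMap ℝ E ℝ => D (Fin.snoc e y)) hBC

end

/-! ### Arens extensions as second adjoints -/

/-- The Arens extension of `z ∘ A`, for a regular `G*`-valued map `A`, is the composition of
`x 0` with `z ∘ T` for some regular operator `T : E 0 → G*` not depending on `z ∈ G**`. -/
theorem exists_regularOp_arensValue_comp (n : ℕ) (E : Fin (n + 1) → Type u)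
    [∀ i, NormedAddCommGroup (E i)] [∀ i, NormedSpace ℝ (E i)] [∀ i, Lattice (E i)]
    [∀ i, IsBanachLattice (E i)]
    (G : Type u) [NormedAddCommGroup G] [NormedSpace ℝ G] [Lattice G] [IsBanachLattice G]
    (h : ∀ i : Fin (n + 1), 0 < i.val → ∀ T : E i →ₗ[ℝ] StrongDual ℝ G,
      IsRegularOp T → IsWeaklyCompactOp T)
    (A : ContinuousMultilinearMap ℝ E (StrongDual ℝ G)) (hA : IsRegular A.toMultilinearMap)
    (x : ∀ i, Bidual (E i)) :
    ∃ (T : E 0 →ₗ[ℝ] StrongDual ℝ G) (hT : IsRegularOp T), ∀ z : Bidual G,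
      arensValue (n + 1) E (z.compContinuousMultilinearMap A) x = x 0 (z.comp hT.toContinuous) := by
  induction n with
  | zero => exact ⟨_, hA.isRegularOp_curryRight_apply fun i => i.elim0, fun z => rfl⟩
  | succ n ih =>
    -- The last vector is absorbed before `z`, against the Arens order; the map stays `G*`-valued
    -- and regular, and the resulting `T` does not involve `z`.
    obtain ⟨T, hT, hTz⟩ := ih (fun i => E i.castSucc) (fun i hi => h i.castSucc hi)
      ((contractDual (E (Fin.last (n + 1))) G (x (Fin.last _))).compContinuousMultilinearMap
        A.curryRight) (hA.contractDual _) fun i => x i.castSucc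
    refine ⟨T, hT, fun z => ?_⟩
    refine Eq.trans ?_ (hTz z)
    rw [arensValue]
    congr 1
    ext e
    -- The change of order is legitimate because, with the other variables frozen at `e`, the
    -- operator into `G*` is weakly compact. The last index is `n + 1 > 0`, so nothing is asked of
    -- the first variable.
    exact IsWeaklyCompactOp.bidual_comm (A.curryRight e)
      (h _ (by simp) _ (hA.isRegularOp_curryRight_apply e)) (x (Fin.last _)) z

/-- In every variable but the first one, the Arens extension of a regular form is of the form
`z ↦ x 0 (z ∘ T)` for some regular operator `T`. -/
theorem exists_regularOp_arensValue_update (n : ℕ) (E : Fin (n + 1) → Type u)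
    [∀ i, NormedAddCommGroup (E i)] [∀ i, NormedSpace ℝ (E i)] [∀ i, Lattice (E i)]
    [∀ i, IsBanachLattice (E i)]
    (h : ∀ j k : Fin (n + 1), 0 < j.val → j < k →
      ∀ T : E j →ₗ[ℝ] StrongDual ℝ (E k), IsRegularOp T → IsWeaklyCompactOp T)
    (A : ContinuousMultilinearMap ℝ E ℝ) (hA : IsRegular A.toMultilinearMap)
    (x : ∀ i, Bidual (E i)) (j : Fin (n + 1)) (hj : 0 < j.val) :
    ∃ (T : E 0 →ₗ[ℝ] StrongDual ℝ (E j)) (hT : IsRegularOp T), ∀ z : Bidual (E j),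
      arensValue (n + 1) E A (Function.update x j z) = x 0 (z.comp hT.toContinuous) := by
  induction n with
  | zero => omega
  | succ n ih =>
    induction j using Fin.lastCases with
    | last =>
      -- With `z` in the last place, the remaining variables form an `E_j*`-valued map.
      obtain ⟨T, hT, hTz⟩ := exists_regularOp_arensValue_comp n (fun i => E i.castSucc)
        (E (Fin.last (n + 1))) (fun i hi => h i.castSucc _ hi i.castSucc_lt_last)
        A.curryRight hA.curryRight fun i => x i.castSucc
      refine ⟨T, hT, fun z => ?_⟩
      refine Eq.trans ?_ (hTz z)
      have hx : (fun i : Fin (n + 1) => Function.update x (Fin.last (n + 1)) z i.castSucc) =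
          fun i : Fin (n + 1) => x i.castSucc := by
        funext i
        exact Function.update_of_ne i.castSucc_lt_last.ne _ _
      rw [arensValue, hx, Function.update_self]
      rfl
    | cast j =>
      -- The last vector is not the one that varies, so it is contracted first, as in the Arens
      -- order.
      obtain ⟨T, hT, hTz⟩ := ih (fun i => E i.castSucc)
        (fun i k hi hik => h i.castSucc k.castSucc hi hik)
        (contractLast (x (Fin.last (n + 1))) A) (hA.contractLast _) (fun i => x i.castSucc) j hj
      refine ⟨T, hT, fun z => ?_⟩
      refine Eq.trans ?_ (hTz z)
      have hx : (fun i : Fin (n + 1) => Function.update x j.castSucc z i.castSucc) =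
          Function.update (fun i : Fin (n + 1) => x i.castSucc) j z := by
        funext i
        by_cases hi : i = j
        · subst hi; simp
        · rw [Function.update_of_ne hi, Function.update_of_ne (by simpa using hi)]
      rw [arensValue, hx, Function.update_of_ne (j.castSucc_lt_last.ne')]

end BLat

end

theorem mainTheorem8 (P : BLat.FunctionalProperty.{u}) (hP : BLat.IsArensProperty P)
    (m : ℕ) (hm : 2 ≤ m) (E : Fin m → Type u) [∀ i, NormedAddCommGroup (E i)]
    [∀ i, NormedSpace ℝ (E i)] [∀ i, Lattice (E i)] [∀ i, BLat.IsBanachLattice (E i)]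
    (h₁ : ∀ j k : Fin m, 0 < j.val → j < k →
      ∀ T : E j →ₗ[ℝ] StrongDual ℝ (E k), BLat.IsRegularOp T → BLat.IsWeaklyCompactOp T)
    (h₂ : ∀ k : Fin m, 0 < k.val →
      ∀ (x : BLat.Bidual (E ⟨0, by omega⟩)) (T : E ⟨0, by omega⟩ →ₗ[ℝ] StrongDual ℝ (E k))
        (hT : BLat.IsRegularOp T),
        P (BLat.Bidual (E k)) (BLat.adjointOp (BLat.adjointOp hT.toContinuous) x).toLinearMap)
    (A : MultilinearMap ℝ E ℝ) (hA : BLat.IsRegular A) :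
    BLat.HasSeparately P (BLat.arensExtension hA.toContinuous) := by
  intro j
  obtain ⟨n, rfl⟩ : ∃ n, m = n + 1 := ⟨m - 1, by omega⟩
  rcases Nat.eq_zero_or_pos j.val with hj | hj
  · rw [show j = ⟨0, by omega⟩ from Fin.ext hj]
    exact hP (n + 1) hm E A hA
  · intro x
    obtain ⟨T, hT, hTz⟩ :=
      BLat.exists_regularOp_arensValue_update n E h₁ hA.toContinuous hA x j hj
    -- Unfolding both adjoints gives `T**(x 0)(z) = x 0 (z ∘ T)`, so `hTz` is already the pointwise
    -- equality.
    have key : (BLat.arensExtension hA.toContinuous).toLinearMap x j =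
        (BLat.adjointOp (BLat.adjointOp hT.toContinuous) (x 0)).toLinearMap :=
      LinearMap.ext hTz
    rw [key]
    exact h₂ j hj (x 0) T hT
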